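/- Let $N\ge 2$, let $\mathcal H_1,\dots,\mathcal H_N$ be complex separable Hilbert spaces and let $\rho$ be a quantum state (a positive operator of trace $1$) on the Hilbert space tensor product $\mathcal H_1\otimes\cdots\otimes\mathcal H_N$. Let $S_1,\dots,S_N\ge 1$ be integers, let $(\Lambda_n,\mathcal F_{\Lambda_n})$, $n=1,\dots,N$, be arbitrary measurable spaces, and for every $n$ and $s_n=1,\dots,S_n$ let $\mathrm M_n^{(s_n)}$ be a normalized positive operator-valued measure on $(\Lambda_n,\mathcal F_{\Lambda_n})$ with values in the bounded operators on $\mathcal H_n$. For every $(s_1,\dots,s_N)$ there is a probability measure $P_{(s_1,\dots,s_N)}$ on the product space $(\Lambda_1\times\cdots\times\Lambda_N,\ \mathcal F_{\Lambda_1}\otimes\cdots\otimes\mathcal F_{\Lambda_N})$ such that $$P_{(s_1,\dots,s_N)}(F_1\times\cdots\times F_N)=\mathrm{tr}\big[\rho\{\mathrm M_1^{(s_1)}(F_1)\otimes\cdots\otimes \mathrm M_N^{(s_N)}(F_N)\}\big],\qquad F_n\in\mathcal F_{\Lambda_n},$$ and every correlation scenario with such joint probability distributions admits a deterministic local quasi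 hidden variable (LqHV) model. That is, there are a measurable space $(\Omega,\mathcal F_\Omega)$, a bounded real-valued ($\sigma$-additive, not necessarily positive) measure $\nu$ on it with $\nu(\Omega)=1$, and, for all $n$ and $s_n$, conditional probability measures $P_n^{(s_n)}(\cdot\,|\,\omega)$ on $(\Lambda_n,\mathcal F_{\Lambda_n})$, defined for $\nu$-almost every $\omega$ and measurable in $\omega$, such that $$P_{(s_1,\dots,s_N)}(F_1\times\cdots\times F_N)=\int_\Omega P_1^{(s_1)}(F_1|\omega)\cdots P_N^{(s_N)}(F_N|\omega)\,\nu(d\omega)$$ for all $s_n$ and all $F_n\in\mathcal F_{\Lambda_n}$, and there are measurable functions $f_{n,s_n}:\Omega\to\Lambda_n$ such that, for $\nu$-almost every $\omega$, $P_n^{(s_n)}(F|\omega)=\chi_{f_{n,s_n}^{-1}(F)}(\omega)$ for all $F\in\mathcal F_{\Lambda_n}$. -/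

import Mathlib

open MeasureTheory ProbabilityTheory
open scoped ComplexConjugate ComplexOrder

noncomputable section

/-! ### Hilbert tensor product of finitely many complex Hilbert spaces -/

section HilbertTensor

variable {ι : Type*} (H : ι → Type*)
  [∀ i, NormedAddCommGroup (H i)] [∀ i, InnerProductSpace ℂ (H i)]

/-- The algebraic tensor product `⨂ i, H i` (a type synonym, so that it can carry the Hilbert
space inner product). -/
def AlgTensor : Type _ := PiTensorProduct ℂ H

instance AlgTensor.instAddCommGroup : AddCommGroup (AlgTensor H) :=
  inferInstanceAs (AddCommGroup (PiTensorProduct ℂ H))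

instance AlgTensor.instModule : Module ℂ (AlgTensor H) :=
  inferInstanceAs (Module ℂ (PiTensorProduct ℂ H))

/-- The elementary tensors `⨂ₜ i, x i`. -/
def AlgTensor.tprod : MultilinearMap ℂ H (AlgTensor H) := PiTensorProduct.tprod ℂ

variable {H}

theorem AlgTensor.linearMap_ext {E : Type*} [AddCommGroup E] [Module ℂ E]
    {f g : AlgTensor H →ₗ[ℂ] E} (h : ∀ x, f (AlgTensor.tprod H x) = g (AlgTensor.tprod H x)) :
    f = g :=
  PiTensorProduct.ext (MultilinearMap.ext h)

theorem AlgTensor.exists_sum (x : AlgTensor H) :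
    ∃ (m : ℕ) (c : Fin m → ℂ) (v : Fin m → ∀ i, H i), x = ∑ k, c k • AlgTensor.tprod H (v k) := by
  have hx : x ∈ Submodule.span ℂ (Set.range (AlgTensor.tprod H)) := by
    have : Submodule.span ℂ (Set.range (AlgTensor.tprod H)) = ⊤ :=
      PiTensorProduct.span_tprod_eq_top
    rw [this]; trivial
  obtain ⟨m, c, g, rfl⟩ := Submodule.mem_span_set'.1 hx
  refine ⟨m, c, fun k => (g k).2.choose, ?_⟩
  exact Finset.sum_congr rfl fun k _ => by rw [(g k).2.choose_spec]

/-- `⨂ i, A i` on the algebraic tensor product, as a linear map. -/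
def AlgTensor.mapₗ (A : ∀ i, H i →L[ℂ] H i) : AlgTensor H →ₗ[ℂ] AlgTensor H :=
  PiTensorProduct.map fun i => (A i).toLinearMap

theorem AlgTensor.mapₗ_tprod (A : ∀ i, H i →L[ℂ] H i) (x : ∀ i, H i) :
    AlgTensor.mapₗ A (AlgTensor.tprod H x) = AlgTensor.tprod H (fun i => A i (x i)) :=
  PiTensorProduct.map_tprod _ _

/-- The Gram matrix of the elementary tensors `⨂ₜ i ∈ s, v k i`. -/
def AlgTensor.gram {m : ℕ} (v : Fin m → ∀ i, H i) (s : Finset ι) : Matrix (Fin m) (Fin m) ℂ :=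
  Matrix.of fun k l => ∏ i ∈ s, inner ℂ (v k i) (v l i)

theorem AlgTensor.gram_insert [DecidableEq ι] {m : ℕ} (v : Fin m → ∀ i, H i) {s : Finset ι} {a : ι}
    (ha : a ∉ s) : AlgTensor.gram v (insert a s) =
      Matrix.hadamard (Matrix.gram ℂ (fun k => v k a)) (AlgTensor.gram v s) := by
  ext k l
  simp [AlgTensor.gram, Matrix.gram, Finset.prod_insert ha]

theorem AlgTensor.gram_posSemidef {m : ℕ} (v : Fin m → ∀ i, H i) (s : Finset ι) :
    (AlgTensor.gram v s).PosSemidef := by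
  classical
  induction s using Finset.induction_on with
  | empty =>
    have : AlgTensor.gram v ∅ = Matrix.gram ℂ (fun _ : Fin m => (1 : ℂ)) := by
      ext k l; simp [AlgTensor.gram, Matrix.gram]
    rw [this]
    exact Matrix.posSemidef_gram (𝕜 := ℂ) (fun _ : Fin m => (1 : ℂ))
  | insert a s ha ih =>
    rw [AlgTensor.gram_insert v ha]
    exact (Matrix.posSemidef_gram (𝕜 := ℂ) (fun k => v k a)).hadamard ih

theorem AlgTensor.gram_map_le {m : ℕ} (A : ∀ i, H i →L[ℂ] H i) (v : Fin m → ∀ i, H i)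
    (s : Finset ι) :
    ((∏ i ∈ s, ‖A i‖ ^ 2) • AlgTensor.gram v s -
      AlgTensor.gram (fun k i => A i (v k i)) s).PosSemidef := by
  classical
  induction s using Finset.induction_on with
  | empty =>
    have : AlgTensor.gram v ∅ = AlgTensor.gram (fun k i => A i (v k i)) ∅ := by
      ext k l; simp [AlgTensor.gram]
    rw [this]
    simpa using Matrix.PosSemidef.zero
  | insert a s ha ih =>
    have h1 := (Matrix.posSemidef_opNorm_smul_gram_sub_gram (𝕜 := ℂ)
      (fun k => v k a) (A a)).hadamard (AlgTensor.gram_posSemidef (fun k i => A i (v k i)) s)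
    have h2 := ((Matrix.posSemidef_gram (𝕜 := ℂ) (fun k => v k a)).hadamard ih).smul
      (sq_nonneg ‖A a‖)
    refine (congrArg Matrix.PosSemidef ?_).mp (h1.add h2)
    rw [AlgTensor.gram_insert _ ha, AlgTensor.gram_insert _ ha, Finset.prod_insert ha]
    ext k l
    simp only [Matrix.sub_apply, Matrix.add_apply, Matrix.smul_apply, Matrix.hadamard_apply,
      Matrix.gram_apply, Function.comp_apply, Complex.real_smul]
    push_cast
    ring

variable [Fintype ι]

/-- The linear functional `⨂ₜ y i ↦ ∏ i, ⟪x i, y i⟫`. -/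
def AlgTensor.innerLeft (x : ∀ i, H i) : AlgTensor H →ₗ[ℂ] ℂ :=
  PiTensorProduct.lift
    ((MultilinearMap.mkPiAlgebra ℂ ι ℂ).compLinearMap (fun i => innerₛₗ ℂ (x i)))

theorem AlgTensor.innerLeft_tprod (x y : ∀ i, H i) :
    AlgTensor.innerLeft x (AlgTensor.tprod H y) = ∏ i, inner ℂ (x i) (y i) := by
  unfold AlgTensor.innerLeft AlgTensor.tprod
  erw [PiTensorProduct.lift.tprod]
  simp

theorem AlgTensor.innerLeft_tprod_conj (x y : ∀ i, H i) :
    AlgTensor.innerLeft x (AlgTensor.tprod H y) =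
      star ((MultilinearMap.mkPiAlgebra ℂ ι ℂ).compLinearMap (fun i => innerₛₗ ℂ (y i)) x) := by
  rw [AlgTensor.innerLeft_tprod]
  simp [star_prod]

/-- The form `(⨂ₜ x i, ⨂ₜ y i) ↦ ∏ i, ⟪y i, x i⟫`, linear in the first and conjugate-linear in the
second argument. -/
def AlgTensor.form : AlgTensor H →ₗ[ℂ] (AlgTensor H →ₗ⋆[ℂ] ℂ) :=
  PiTensorProduct.lift
    { toFun := fun x =>
        (starLinearEquiv ℂ (A := ℂ)).toLinearMap.comp (AlgTensor.innerLeft x)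
      map_update_add' := by
        intro inst x i a b
        have : AlgTensor.innerLeft (Function.update x i (a + b)) =
            AlgTensor.innerLeft (Function.update x i a) +
            AlgTensor.innerLeft (Function.update x i b) := by
          apply AlgTensor.linearMap_ext
          intro y
          simp only [LinearMap.add_apply, AlgTensor.innerLeft_tprod_conj,
            MultilinearMap.map_update_add, star_add]
        rw [this, LinearMap.comp_add]
      map_update_smul' := by
        intro inst x i c a
        have : AlgTensor.innerLeft (Function.update x i (c • a)) =
            star c • AlgTensor.innerLeft (Function.update x i a) := by
          apply AlgTensor.linearMap_ext
          intro y
          simp only [LinearMap.smul_apply, AlgTensor.innerLeft_tprod_conj,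
            MultilinearMap.map_update_smul, star_smul]
        rw [this]
        ext y
        simp }

theorem AlgTensor.form_tprod (x y : ∀ i, H i) :
    AlgTensor.form (AlgTensor.tprod H x) (AlgTensor.tprod H y) = ∏ i, inner ℂ (y i) (x i) := by
  have h : AlgTensor.form (AlgTensor.tprod H x) =
      (starLinearEquiv ℂ (A := ℂ)).toLinearMap.comp (AlgTensor.innerLeft x) := by
    unfold AlgTensor.form AlgTensor.tprod
    erw [PiTensorProduct.lift.tprod]
    rfl
  rw [h]
  simp [AlgTensor.innerLeft_tprod]

instance AlgTensor.instInner : Inner ℂ (AlgTensor H) := ⟨fun y x => AlgTensor.form x y⟩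

theorem AlgTensor.inner_tprod (x y : ∀ i, H i) :
    inner ℂ (AlgTensor.tprod H x) (AlgTensor.tprod H y) = ∏ i, inner ℂ (x i) (y i) :=
  AlgTensor.form_tprod y x

theorem AlgTensor.inner_sum {m m' : ℕ} (c : Fin m → ℂ) (v : Fin m → ∀ i, H i)
    (d : Fin m' → ℂ) (w : Fin m' → ∀ i, H i) :
    inner ℂ (∑ k, c k • AlgTensor.tprod H (v k)) (∑ k, d k • AlgTensor.tprod H (w k)) =
      ∑ k, ∑ l, conj (c k) * d l * ∏ i, inner ℂ (v k i) (w l i) := by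
  change AlgTensor.form (∑ k, d k • AlgTensor.tprod H (w k))
    (∑ k, c k • AlgTensor.tprod H (v k)) = _
  simp only [map_sum, LinearMap.sum_apply, LinearMap.map_smulₛₗ, LinearMap.smul_apply,
    AlgTensor.form_tprod, smul_eq_mul, RingHom.id_apply]
  refine Finset.sum_congr rfl fun k _ => ?_
  rw [Finset.mul_sum]
  exact Finset.sum_congr rfl fun l _ => by ring

theorem AlgTensor.inner_self_sum {m : ℕ} (c : Fin m → ℂ) (v : Fin m → ∀ i, H i) :
    inner ℂ (∑ k, c k • AlgTensor.tprod H (v k)) (∑ k, c k • AlgTensor.tprod H (v k)) =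
      dotProduct (star c) ((AlgTensor.gram v Finset.univ).mulVec c) := by
  rw [AlgTensor.inner_sum]
  simp only [dotProduct, Matrix.mulVec, Finset.mul_sum, AlgTensor.gram, Matrix.of_apply,
    Pi.star_apply]
  refine Finset.sum_congr rfl fun k _ => Finset.sum_congr rfl fun l _ => ?_
  simp only [RCLike.star_def]
  ring

variable (H) in
/-- The Hilbert space inner product on the algebraic tensor product, determined by
`⟪⨂ₜ x i, ⨂ₜ y i⟫ = ∏ i, ⟪x i, y i⟫`. -/
@[reducible]
def AlgTensor.core : PreInnerProductSpace.Core ℂ (AlgTensor H) where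
  inner x y := inner ℂ x y
  conj_inner_symm x y := by
    obtain ⟨m, c, v, rfl⟩ := AlgTensor.exists_sum x
    obtain ⟨m', d, w, rfl⟩ := AlgTensor.exists_sum y
    rw [AlgTensor.inner_sum, AlgTensor.inner_sum, Finset.sum_comm]
    simp only [map_sum, map_mul, map_prod, inner_conj_symm, Complex.conj_conj]
    exact Finset.sum_congr rfl fun k _ => Finset.sum_congr rfl fun l _ => by ring
  re_inner_nonneg x := by
    obtain ⟨m, c, v, rfl⟩ := AlgTensor.exists_sum x
    rw [AlgTensor.inner_self_sum]
    exact (AlgTensor.gram_posSemidef v _).re_dotProduct_nonneg c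
  add_left x y z := by
    change AlgTensor.form z (x + y) = AlgTensor.form z x + AlgTensor.form z y
    exact map_add _ _ _
  smul_left x y c := by
    change AlgTensor.form y (c • x) = conj c * AlgTensor.form y x
    simp

instance AlgTensor.instSeminormedAddCommGroup : SeminormedAddCommGroup (AlgTensor H) :=
  @InnerProductSpace.Core.toSeminormedAddCommGroup ℂ (AlgTensor H) _ _ _ (AlgTensor.core H)

instance AlgTensor.instInnerProductSpace : InnerProductSpace ℂ (AlgTensor H) :=
  InnerProductSpace.ofCore (AlgTensor.core H)

theorem AlgTensor.norm_mapₗ_le (A : ∀ i, H i →L[ℂ] H i) (x : AlgTensor H) :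
    ‖AlgTensor.mapₗ A x‖ ≤ (∏ i, ‖A i‖) * ‖x‖ := by
  have hc : 0 ≤ ∏ i, ‖A i‖ := Finset.prod_nonneg fun i _ => norm_nonneg _
  refine le_of_sq_le_sq ?_ (mul_nonneg hc (norm_nonneg _))
  rw [mul_pow, ← inner_self_eq_norm_sq (𝕜 := ℂ), ← inner_self_eq_norm_sq (𝕜 := ℂ)]
  obtain ⟨m, c, v, rfl⟩ := AlgTensor.exists_sum x
  simp only [map_sum, map_smul, AlgTensor.mapₗ_tprod]
  have h := (AlgTensor.gram_map_le A v Finset.univ).re_dotProduct_nonneg c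
  have e1 := AlgTensor.inner_self_sum c v
  have e2 := AlgTensor.inner_self_sum c (fun k i => A i (v k i))
  erw [e1, e2]
  rw [Matrix.sub_mulVec, dotProduct_sub, Matrix.smul_mulVec, dotProduct_smul, map_sub,
    Finset.prod_pow] at h
  rw [Complex.real_smul] at h
  simpa [← Complex.ofReal_pow] using h

/-- `⨂ i, A i` on the algebraic tensor product, as a bounded operator. -/
def AlgTensor.mapL (A : ∀ i, H i →L[ℂ] H i) : AlgTensor H →L[ℂ] AlgTensor H :=
  (AlgTensor.mapₗ A).mkContinuous (∏ i, ‖A i‖) (AlgTensor.norm_mapₗ_le A)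

variable (H) in
/-- The Hilbert space tensor product `⨂ i, H i`: the completion of the algebraic tensor product
for the inner product `⟪⨂ₜ x i, ⨂ₜ y i⟫ = ∏ i, ⟪x i, y i⟫`. -/
abbrev HilbertTensor : Type _ := UniformSpace.Completion (AlgTensor H)

/-- The elementary tensors `x 1 ⊗ ⋯ ⊗ x N` in the Hilbert space tensor product. -/
def HilbertTensor.tprod (x : ∀ i, H i) : HilbertTensor H := (AlgTensor.tprod H x : AlgTensor H)

/-- The bounded operator `A 1 ⊗ ⋯ ⊗ A N` on the Hilbert space tensor product. -/
def tensorOp (A : ∀ i, H i →L[ℂ] H i) : HilbertTensor H →L[ℂ] HilbertTensor H :=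
  (AlgTensor.mapL A).completion

theorem HilbertTensor.inner_tprod (x y : ∀ i, H i) :
    inner ℂ (HilbertTensor.tprod x) (HilbertTensor.tprod y) = ∏ i, inner ℂ (x i) (y i) := by
  rw [← AlgTensor.inner_tprod]
  exact UniformSpace.Completion.inner_coe _ _

theorem tensorOp_tprod (A : ∀ i, H i →L[ℂ] H i) (x : ∀ i, H i) :
    tensorOp A (HilbertTensor.tprod x) = HilbertTensor.tprod (fun i => A i (x i)) := by
  unfold tensorOp HilbertTensor.tprod
  rw [← AlgTensor.mapₗ_tprod]
  simp [AlgTensor.mapL]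

end HilbertTensor

/-! ### Trace, quantum states and POV measures -/

section Quantum

variable {K : Type*} [NormedAddCommGroup K] [InnerProductSpace ℂ K]

/-- `tr A = t`: the bounded operator `A` has trace `t`, that is, in every orthonormal basis the
diagonal matrix elements of `A` are summable, with sum `t`. -/
def HasTrace (A : K →L[ℂ] K) (t : ℂ) : Prop :=
  ∀ (w : Set K) (b : HilbertBasis w ℂ K), HasSum (fun i => inner ℂ (b i) (A (b i))) t

/-- A quantum state (density operator): a positive operator with trace one. -/
structure IsQuantumState (ρ : K →L[ℂ] K) : Prop where
  isPositive : ρ.IsPositive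
  hasTrace_one : HasTrace ρ 1

/-- A normalized positive operator-valued measure on a measurable space `Λ`, with values in the
bounded operators on `K`; `σ`-additivity is in the weak operator topology. The values
outside the `σ`-algebra play no role. -/
structure POVMeasure (Λ : Type*) [MeasurableSpace Λ] (K : Type*) [NormedAddCommGroup K]
    [InnerProductSpace ℂ K] where
  /-- the operator `M(F)` of an event `F` -/
  toFun : Set Λ → (K →L[ℂ] K)
  isPositive : ∀ F, MeasurableSet F → (toFun F).IsPositive
  univ_eq_one : toFun Set.univ = 1
  hasSum_iUnion : ∀ F : ℕ → Set Λ, (∀ k, MeasurableSet (F k)) →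
    Pairwise (Function.onFun Disjoint F) → ∀ x y : K,
      HasSum (fun k => inner ℂ x (toFun (F k) y)) (inner ℂ x (toFun (⋃ k, F k) y))

end Quantum

/-! ### Correlation scenarios and (deterministic) LqHV models -/

section Scenario

universe v

variable {N : ℕ} {S : Fin N → ℕ} {Λ : Fin N → Type v} [∀ n, MeasurableSpace (Λ n)]

/-- The probabilistic description of an `S 1 × ⋯ × S N`-setting correlation scenario: a joint
probability distribution on `Λ 1 × ⋯ × Λ N` (with the product `σ`-algebra) for every choice
`s = (s 1, …, s N)` of settings. -/
abbrev CorrelationScenario (S : Fin N → ℕ) (Λ : Fin N → Type v) [∀ n, MeasurableSpace (Λ n)] :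
    Type v :=
  (∀ n, Fin (S n)) → ProbabilityMeasure (∀ n, Λ n)

/-- The scenario `P` is the quantum scenario on `ρ` with measurements `M n s`:
`P_(s 1, …, s N)(F 1 × ⋯ × F N) = tr[ρ (M 1 (s 1) (F 1) ⊗ ⋯ ⊗ M N (s N) (F N))]`. -/
def IsQuantumScenario {H : Fin N → Type*} [∀ n, NormedAddCommGroup (H n)]
    [∀ n, InnerProductSpace ℂ (H n)] (ρ : HilbertTensor H →L[ℂ] HilbertTensor H)
    (M : ∀ n, Fin (S n) → POVMeasure (Λ n) (H n)) (P : CorrelationScenario S Λ) : Prop :=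
  ∀ (s : ∀ n, Fin (S n)) (F : ∀ n, Set (Λ n)), (∀ n, MeasurableSet (F n)) →
    HasTrace (ρ ∘L tensorOp (fun n => (M n (s n)).toFun (F n)))
      (((P s : Measure (∀ n, Λ n)).real (Set.pi Set.univ F) : ℝ) : ℂ)

/-- The integral of a real function against a bounded real-valued measure `ν = ν⁺ - ν⁻`
(Jordan decomposition). -/
def signedIntegral {Ω : Type*} [MeasurableSpace Ω] (ν : SignedMeasure Ω) (g : Ω → ℝ) : ℝ :=
  ∫ ω, g ω ∂ν.toJordanDecomposition.posPart - ∫ ω, g ω ∂ν.toJordanDecomposition.negPart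

/-- A local quasi hidden variable (LqHV) model for the scenario `P`: a measure space `(Ω, ν)` with a
normalized bounded real-valued measure `ν`, and for each site `n` and setting `s n`
a conditional probability measure `P n (s n) (· | ω)`, defined `ν`-almost everywhere and
measurable in `ω`, such that
`P_(s 1, …, s N)(F 1 × ⋯ × F N) = ∫ P 1 (s 1) (F 1 | ω) ⋯ P N (s N) (F N | ω) ν(dω)`.
(A `SignedMeasure` is finite-valued and `σ`-additive, hence bounded.) -/
structure LqHVModel (P : CorrelationScenario S Λ) where
  Ω : Type v
  [instMeasurableSpace : MeasurableSpace Ω]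
  ν : SignedMeasure Ω
  normalized : ν Set.univ = 1
  condProb : ∀ n, Fin (S n) → Kernel Ω (Λ n)
  isProbabilityMeasure_condProb : ∀ n s, ∀ᵐ ω ∂ν.totalVariation,
    IsProbabilityMeasure (condProb n s ω)
  representation : ∀ (s : ∀ n, Fin (S n)) (F : ∀ n, Set (Λ n)), (∀ n, MeasurableSet (F n)) →
    (P s : Measure (∀ n, Λ n)).real (Set.pi Set.univ F) =
      signedIntegral ν (fun ω => ∏ n, (condProb n (s n) ω).real (F n))

attribute [instance] LqHVModel.instMeasurableSpace

/-- An LqHV model is deterministic if there are measurable functions `f n s : Ω → Λ n` such that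
`P n s (F | ω) = χ_{(f n s)⁻¹(F)}(ω)` for all events `F`, for `ν`-almost every `ω`. -/
def LqHVModel.IsDeterministic {P : CorrelationScenario S Λ} (m : LqHVModel P) : Prop :=
  ∃ f : ∀ n, Fin (S n) → m.Ω → Λ n, (∀ n s, Measurable (f n s)) ∧
    ∀ n s, ∀ᵐ ω ∂m.ν.totalVariation, ∀ F : Set (Λ n), MeasurableSet F →
      (m.condProb n s ω).real F = (f n s ⁻¹' F).indicator (fun _ => (1 : ℝ)) ω

/-- The scenario `P` admits a deterministic LqHV model. -/
def AdmitsDeterministicLqHV (P : CorrelationScenario S Λ) : Prop :=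
  ∃ m : LqHVModel P, m.IsDeterministic

end Scenario

end

/-!
The state `ρ = R²` is a mixture of vector states, `tr (ρ A) = ∑ ⟪ψ j, A (ψ j)⟫` with `ψ j = R (b j)`
for any orthonormal basis `b` (`IsQuantumState.exists_vectors`). So the joint distributions exist
as soon as `F ↦ ⟪ψ, (⨂ M n (F n)) ψ⟫` extends from boxes to a measure for every vector `ψ`
(`exists_measure_pi_eq_inner`). On arbitrary measurable spaces a function that is only
countably additive in each argument need not extend; here it does because of the tensor product
structure. For an elementary tensor `ψ` one obtains a product measure. By positivity, the content of
a finite sum of elementary tensors is dominated by a finite measure, and the content of any `ψ` is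
dominated by twice such a content up to an arbitrarily small constant, hence it is continuous at `∅`
(`exists_measure_eq_quadContent`).

The LqHV model needs no quantum theory beyond the absence of signalling, which follows from
`M(Λ) = 1`. Take for `Ω` the space of lists `z` of outcomes `z n σ` for all sites `n` and all
settings `σ`, with the coordinates as response functions. For every selection `t` of at most one
setting at each site, let `Q t` be the law on `Ω` under which the selected outcomes are distributed
as in the scenario, and all others are independent with their own marginals. Put
`ν = ∑ t, (∏ n, w (t n)) • Q t` with `w = 1` for a selected setting and `w = 1 - S n` if none is
selected at `n`. To test the settings `s`, only the sites where `t n = s n` matter: the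
`S n - 1` other settings and the empty selection have total weight zero, so that exactly the term
`t = s` survives, and `ν` has the required marginals (`quasiLaw_settings`).
-/

/-! ### The trace of a state composed with a bounded operator -/

section Trace

variable {K : Type*} [NormedAddCommGroup K] [InnerProductSpace ℂ K]

/-- Parseval's identity in summable form. -/
theorem HilbertBasis.hasSum_norm_inner_sq {ι : Type*} (b : HilbertBasis ι ℂ K) (x : K) :
    HasSum (fun i => ‖inner ℂ x (b i)‖ ^ 2) (‖x‖ ^ 2) := by
  have h := (b.hasSum_inner_mul_inner x x).mapL Complex.reCLM
  rw [inner_self_eq_norm_sq_to_K] at h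
  convert! h using 1
  · ext i
    rw [← inner_conj_symm (b i) x, RCLike.mul_conj]
    simp [← Complex.ofReal_pow]
  · simp [← Complex.ofReal_pow]

variable [CompleteSpace K]

theorem ContinuousLinearMap.IsPositive.exists_sqrt {A : K →L[ℂ] K} (hA : A.IsPositive) :
    ∃ R : K →L[ℂ] K, IsSelfAdjoint R ∧ A = R ∘L R := by
  have h0 := (ContinuousLinearMap.nonneg_iff_isPositive A).2 hA
  exact ⟨CFC.sqrt A, (CFC.sqrt_nonneg A).isSelfAdjoint, (CFC.sqrt_mul_sqrt_self A h0).symm⟩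

/-- If `R` is a self-adjoint Hilbert-Schmidt operator, then `tr (R² A)` may be computed
as `∑ ⟪R b, A R b⟫` over one orthonormal basis: both sides are iterated sums of one absolutely
summable double series. -/
theorem hasTrace_sq_comp {ι : Type*} (b : HilbertBasis ι ℂ K) {R : K →L[ℂ] K}
    (hR : IsSelfAdjoint R) (hs : Summable fun i => ‖R (b i)‖ ^ 2) (A : K →L[ℂ] K) :
    Summable (fun i => inner ℂ (R (b i)) (A (R (b i)))) ∧
      HasTrace ((R ∘L R) ∘L A) (∑' i, inner ℂ (R (b i)) (A (R (b i)))) := by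
  have hRs : ∀ x y, inner ℂ (R x) y = inner ℂ x (R y) := fun x y => by
    rw [← ContinuousLinearMap.adjoint_inner_right, hR.adjoint_eq]
  -- the double series is `⟪A† R b i, c j⟫ ⟪c j, R b i⟫ = ⟪R c j, b i⟫ ⟪b i, R A c j⟫`
  have key : ∀ {κ : Type _} (c : HilbertBasis κ ℂ K), ∃ a : ℂ,
      HasSum (fun i => inner ℂ (R (b i)) (A (R (b i)))) a ∧
      HasSum (fun j => inner ℂ (c j) (R (R (A (c j))))) a := by
    intro κ c
    let B := ContinuousLinearMap.adjoint A
    let f : ι × κ → ℂ := fun p => inner ℂ (B (R (b p.1))) (c p.2) * inner ℂ (c p.2) (R (b p.1))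
    have aux : ∀ v : ι → K, Summable (fun i => ‖v i‖ ^ 2) →
        Summable fun p : ι × κ => ‖inner ℂ (v p.1) (c p.2)‖ ^ 2 := by
      intro v hv
      rw [summable_prod_of_nonneg (fun p => by positivity)]
      exact ⟨fun i => (c.hasSum_norm_inner_sq (v i)).summable,
        by simpa only [(c.hasSum_norm_inner_sq _).tsum_eq] using hv⟩
    have hB : Summable fun i => ‖B (R (b i))‖ ^ 2 := by
      refine Summable.of_nonneg_of_le (fun i => by positivity) (fun i => ?_) (hs.mul_left (‖B‖ ^ 2))
      rw [← mul_pow]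
      gcongr
      exact B.le_opNorm _
    have hf : Summable f := by
      refine Summable.of_norm_bounded ((aux _ hB).add (aux _ hs)) fun p => ?_
      rw [norm_mul, norm_inner_symm (c p.2)]
      nlinarith [sq_nonneg (‖inner ℂ (B (R (b p.1))) (c p.2)‖ - ‖inner ℂ (R (b p.1)) (c p.2)‖),
        sq_nonneg (‖inner ℂ (B (R (b p.1))) (c p.2)‖), sq_nonneg ‖inner ℂ (R (b p.1)) (c p.2)‖]
    refine ⟨∑' p, f p, hf.hasSum.prod_fiberwise fun i => ?_,
      ((Equiv.prodComm κ ι).hasSum_iff.mpr hf.hasSum).prod_fiberwise fun j => ?_⟩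
    · have h := c.hasSum_inner_mul_inner (B (R (b i))) (R (b i))
      rwa [ContinuousLinearMap.adjoint_inner_left] at h
    · have h := b.hasSum_inner_mul_inner (R (c j)) (R (A (c j)))
      rw [hRs] at h
      convert! h using 1
      ext i
      simp only [f, Function.comp_apply, Equiv.prodComm_apply, Prod.swap_prod_mk, B]
      rw [ContinuousLinearMap.adjoint_inner_left, hRs (b i), hRs (c j), mul_comm]
  obtain ⟨w, c, -⟩ := exists_hilbertBasis ℂ K
  obtain ⟨a, ha, -⟩ := key c
  refine ⟨ha.summable, fun w' c' => ?_⟩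
  obtain ⟨a', ha', hc'⟩ := key c'
  rw [ha'.tsum_eq]
  exact hc'

theorem HasTrace.unique {A : K →L[ℂ] K} {s t : ℂ} (hs : HasTrace A s) (ht : HasTrace A t) :
    s = t := by
  obtain ⟨w, b, -⟩ := exists_hilbertBasis ℂ K
  exact (hs w b).unique (ht w b)

/-- A quantum state is a mixture of vector states: there are vectors `ψ i` (not normalised) with
`∑ ‖ψ i‖² = 1` and `tr (ρ A) = ∑ ⟪ψ i, A (ψ i)⟫` for every bounded operator `A`. -/
theorem IsQuantumState.exists_vectors {ρ : K →L[ℂ] K} (hρ : IsQuantumState ρ) :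
    ∃ (w : Set K) (ψ : w → K), HasSum (fun i => ‖ψ i‖ ^ 2) 1 ∧
      ∀ A : K →L[ℂ] K, Summable (fun i => inner ℂ (ψ i) (A (ψ i))) ∧
        HasTrace (ρ ∘L A) (∑' i, inner ℂ (ψ i) (A (ψ i))) := by
  obtain ⟨R, hR, rfl⟩ := hρ.isPositive.exists_sqrt
  obtain ⟨w, b, -⟩ := exists_hilbertBasis ℂ K
  have h1 : HasSum (fun i => ‖R (b i)‖ ^ 2) 1 := by
    have h := (hρ.hasTrace_one w b).mapL Complex.reCLM
    convert! h using 1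
    ext i
    rw [ContinuousLinearMap.comp_apply, ← ContinuousLinearMap.adjoint_inner_left, hR.adjoint_eq,
      inner_self_eq_norm_sq_to_K]
    simp [← Complex.ofReal_pow]
  exact ⟨w, fun i => R (b i), h1, hasTrace_sq_comp b hR h1.summable⟩

end Trace

/-! ### Extending operator-valued contents -/

section Content

open scoped ENNReal Topology

theorem ContinuousLinearMap.IsPositive.re_inner_add_le {K : Type*} [NormedAddCommGroup K]
    [InnerProductSpace ℂ K] {A : K →L[ℂ] K} (hA : A.IsPositive) (x y : K) :
    (inner ℂ (x + y) (A (x + y))).re ≤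
      2 * (inner ℂ x (A x)).re + 2 * (inner ℂ y (A y)).re := by
  have h := (Complex.le_def.1 (hA.inner_nonneg_right (x - y))).1
  simp only [map_add, map_sub, inner_add_left, inner_add_right, inner_sub_left, inner_sub_right,
    Complex.add_re, Complex.sub_re, Complex.zero_re] at h ⊢
  linarith

variable {α : Type*} {C : Set (Set α)} {K : Type*} [NormedAddCommGroup K] [InnerProductSpace ℂ K]

/-- The content `s ↦ ⟪ψ, T(s) ψ⟫` of an additive set function `T` whose values are positive
operators. -/
noncomputable def quadContent (T : AddContent (K →L[ℂ] K) C)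
    (hT : ∀ s ∈ C, (T s).IsPositive) (ψ : K) :
    AddContent ℝ≥0∞ C where
  toFun s := ENNReal.ofReal (inner ℂ ψ (T s ψ)).re
  empty' := by simp
  sUnion' I hI hd hU := by
    rw [addContent_sUnion hI hd hU, ← ENNReal.ofReal_sum_of_nonneg]
    · simp
    · exact fun s hs => (Complex.le_def.1 ((hT s (hI hs)).inner_nonneg_right ψ)).1

variable {T : AddContent (K →L[ℂ] K) C} {hT : ∀ s ∈ C, (T s).IsPositive}

theorem quadContent_apply (ψ : K) (s : Set α) :
    quadContent T hT ψ s = ENNReal.ofReal (inner ℂ ψ (T s ψ)).re := rfl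

theorem quadContent_add_le (x y : K) {s : Set α} (hs : s ∈ C) :
    quadContent T hT (x + y) s ≤ 2 * quadContent T hT x s + 2 * quadContent T hT y s := by
  have hx := (Complex.le_def.1 ((hT s hs).inner_nonneg_right x)).1
  have hy := (Complex.le_def.1 ((hT s hs).inner_nonneg_right y)).1
  simp only [Complex.zero_re] at hx hy
  have e : ∀ r : ℝ, 2 * ENNReal.ofReal r = ENNReal.ofReal (2 * r) := fun r => by
    rw [ENNReal.ofReal_mul (by norm_num)]; simp
  simp only [quadContent_apply, e]
  rw [← ENNReal.ofReal_add (by positivity) (by positivity)]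
  exact ENNReal.ofReal_le_ofReal ((hT s hs).re_inner_add_le x y)

theorem quadContent_smul (c : ℂ) (x : K) (s : Set α) :
    quadContent T hT (c • x) s = ENNReal.ofReal (‖c‖ ^ 2) * quadContent T hT x s := by
  rw [quadContent_apply, quadContent_apply, ← ENNReal.ofReal_mul (by positivity), map_smul,
    inner_smul_left, inner_smul_right, ← mul_assoc, mul_comm (conj c), Complex.mul_conj,
    Complex.normSq_eq_norm_sq, Complex.re_ofReal_mul]

theorem AddContent.supClosure_le_add (hC : IsSetSemiring C) {m m₁ m₂ : AddContent ℝ≥0∞ C}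
    (h : ∀ s ∈ C, m s ≤ 2 * m₁ s + 2 * m₂ s) {s : Set α}
    (hs : s ∈ supClosure C) :
    m.supClosure hC s ≤ 2 * m₁.supClosure hC s + 2 * m₂.supClosure hC s := by
  obtain ⟨P, hP⟩ := hC.mem_supClosure_iff.1 hs
  simp only [AddContent.supClosure_apply_finpartition hC _ hP, Finset.mul_sum,
    ← Finset.sum_add_distrib]
  exact Finset.sum_le_sum fun t ht => h t (hP ht)

variable [mα : MeasurableSpace α]

variable (T hT) in
/-- The vectors `x` for which the content `s ↦ ⟪x, T(s) x⟫` is dominated by a finite measure. -/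
def dominatedVectors : Submodule ℂ K where
  carrier := {x | ∃ μ : Measure α, IsFiniteMeasure μ ∧ ∀ s ∈ C, quadContent T hT x s ≤ μ s}
  zero_mem' := ⟨0, inferInstance, fun s _ => by simp [quadContent_apply]⟩
  add_mem' := by
    rintro x y ⟨μ, _, hμ⟩ ⟨ν, _, hν⟩
    refine ⟨(2 : NNReal) • μ + (2 : NNReal) • ν, inferInstance, fun s hs => ?_⟩
    refine (quadContent_add_le x y hs).trans ?_
    simp only [Measure.coe_add, Measure.coe_nnreal_smul_apply, Pi.add_apply, ENNReal.coe_ofNat]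
    gcongr
    · exact hμ s hs
    · exact hν s hs
  smul_mem' := by
    rintro c x ⟨μ, _, hμ⟩
    refine ⟨(‖c‖ ^ 2).toNNReal • μ, inferInstance, fun s hs => ?_⟩
    rw [quadContent_smul, Measure.coe_nnreal_smul_apply]
    gcongr
    · rfl
    · exact hμ s hs

theorem AddContent.supClosure_le_measure (hC : IsSetSemiring C) (hCm : ∀ s ∈ C, MeasurableSet s)
    {m : AddContent ℝ≥0∞ C} {μ : Measure α} (h : ∀ s ∈ C, m s ≤ μ s) {s : Set α}
    (hs : s ∈ supClosure C) : m.supClosure hC s ≤ μ s := by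
  obtain ⟨P, hP⟩ := hC.mem_supClosure_iff.1 hs
  rw [AddContent.supClosure_apply_finpartition hC m hP]
  nth_rewrite 2 [← P.sup_parts]
  rw [Finset.sup_set_eq_biUnion, measure_biUnion_finset P.disjoint fun b hb => hCm _ (hP hb)]
  exact Finset.sum_le_sum fun t ht => h t (hP ht)

/-- Let `T` be an additive function with positive values on a semiring of sets which generates the
`σ`-algebra. If the vectors `x` with `⟪x, T(·) x⟫` dominated by a finite measure are dense, then
`⟪ψ, T(·) ψ⟫` extends to a measure for every `ψ`. Indeed for sets of the generated ring
`⟪ψ, T(s) ψ⟫ ≤ 2 ⟪x, T(s) x⟫ + 2 ⟪ψ - x, T(univ) (ψ - x)⟫`, where the second summand is small for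
a suitable dominated `x` and the first tends to zero along `s ↓ ∅`. -/
theorem exists_measure_eq_quadContent (hC : IsSetSemiring C)
    (hgen : mα = MeasurableSpace.generateFrom C) (huniv : Set.univ ∈ C)
    (hd : (dominatedVectors T hT).topologicalClosure = ⊤) (ψ : K) :
    ∃ μ : Measure α, ∀ s ∈ C, μ s = quadContent T hT ψ s := by
  have hCm : ∀ s ∈ C, MeasurableSet s := fun s hs => by
    rw [hgen]; exact MeasurableSpace.measurableSet_generateFrom hs
  have hR := hC.isSetRing_supClosure
  have hle : ∀ (φ : K) s, s ∈ supClosure C →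
      (quadContent T hT φ).supClosure hC s ≤ quadContent T hT φ Set.univ := fun φ s hs => by
    rw [← AddContent.supClosure_apply_of_mem hC _ huniv]
    exact addContent_mono hR.isSetSemiring hs (subset_supClosure huniv) (Set.subset_univ s)
  have hnull : ∀ ⦃s : ℕ → Set α⦄, (∀ n, s n ∈ supClosure C) → Antitone s → ⋂ n, s n = ∅ →
      Filter.Tendsto (fun n => (quadContent T hT ψ).supClosure hC (s n)) Filter.atTop (𝓝 0) := by
    intro s hs hanti hempty
    have hsm : ∀ n, MeasurableSet (s n) := fun n => by
      obtain ⟨P, hP⟩ := hC.mem_supClosure_iff.1 (hs n)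
      rw [← P.sup_parts, Finset.sup_set_eq_biUnion]
      exact Finset.measurableSet_biUnion _ fun b hb => hCm _ (hP hb)
    rw [ENNReal.tendsto_nhds_zero]
    intro ε hε
    have hε4 : 0 < ε / 4 := ENNReal.div_pos hε.ne' (by simp)
    obtain ⟨x, ⟨μ, _, hμ⟩, hx⟩ : ∃ x ∈ dominatedVectors T hT,
        quadContent T hT (ψ - x) Set.univ < ε / 4 := by
      have hmem : ψ ∈ closure (dominatedVectors T hT : Set K) := by
        rw [← Submodule.topologicalClosure_coe, hd]; trivial
      have hcont : ContinuousAt (fun x => quadContent T hT (ψ - x) Set.univ) ψ := by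
        simp only [quadContent_apply]
        exact ENNReal.continuous_ofReal.continuousAt.comp (by fun_prop)
      have h0 : ∀ᶠ x in 𝓝 ψ, quadContent T hT (ψ - x) Set.univ < ε / 4 := by
        refine hcont.eventually_lt_const ?_
        simpa [quadContent_apply] using hε4
      obtain ⟨x, hx1, hx2⟩ := ((mem_closure_iff_frequently.1 hmem).and_eventually h0).exists
      exact ⟨x, hx1, hx2⟩
    have hμs : Filter.Tendsto (fun n => μ (s n)) Filter.atTop (𝓝 0) := by
      have h := tendsto_measure_iInter_atTop (μ := μ)
        (fun n => (hsm n).nullMeasurableSet) hanti ⟨0, measure_ne_top μ _⟩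
      rwa [hempty, measure_empty] at h
    filter_upwards [hμs.eventually_lt_const hε4] with n hn
    have h1 := AddContent.supClosure_le_add hC (m := quadContent T hT ψ)
      (m₁ := quadContent T hT x) (m₂ := quadContent T hT (ψ - x))
      (fun t ht => by simpa using quadContent_add_le (hT := hT) x (ψ - x) ht) (hs n)
    calc _ ≤ _ := h1
      _ ≤ 2 * (ε / 4) + 2 * (ε / 4) := by
        gcongr
        · exact (AddContent.supClosure_le_measure hC hCm hμ (hs n)).trans hn.le
        · exact (hle _ _ (hs n)).trans hx.le
      _ = 4 * (ε / 4) := by ring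
      _ = ε := ENNReal.mul_div_cancel (by simp) (by simp)
  have hσ := isSigmaSubadditive_of_addContent_iUnion_eq_tsum hR
    (addContent_iUnion_eq_sum_of_tendsto_zero hR ((quadContent T hT ψ).supClosure hC)
      (fun s hs => ((hle ψ s hs).trans_lt ENNReal.ofReal_lt_top).ne) hnull)
  have hgen' : mα = MeasurableSpace.generateFrom (supClosure C) := by
    refine le_antisymm ?_ (MeasurableSpace.generateFrom_le fun s hs => ?_)
    · conv_lhs => rw [hgen]
      exact MeasurableSpace.generateFrom_mono subset_supClosure
    · obtain ⟨P, hP⟩ := hC.mem_supClosure_iff.1 hs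
      rw [← P.sup_parts, Finset.sup_set_eq_biUnion]
      exact Finset.measurableSet_biUnion _ fun b hb => hCm _ (hP hb)
  refine ⟨_, fun s hs => (AddContent.measure_eq _ hR.isSetSemiring hgen' hσ
    (subset_supClosure hs)).trans (AddContent.supClosure_apply_of_mem hC _ hs)⟩

end Content

/-! ### Operators on the Hilbert tensor product -/

section TensorOp

variable {ι : Type*} [Fintype ι] {H : ι → Type*} [∀ i, NormedAddCommGroup (H i)]
  [∀ i, InnerProductSpace ℂ (H i)]

theorem HilbertTensor.topologicalClosure_span_tprod :
    (Submodule.span ℂ (Set.range (HilbertTensor.tprod (H := H)))).topologicalClosure = ⊤ := by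
  rw [← Submodule.dense_iff_topologicalClosure_eq_top]
  refine (UniformSpace.Completion.denseRange_coe (α := AlgTensor H)).mono ?_
  rintro _ ⟨x, rfl⟩
  obtain ⟨m, c, v, rfl⟩ := AlgTensor.exists_sum x
  have e : ((∑ k, c k • AlgTensor.tprod H (v k) : AlgTensor H) : HilbertTensor H) =
      ∑ k, c k • HilbertTensor.tprod (v k) :=
    (map_sum (UniformSpace.Completion.toComplL (𝕜 := ℂ) (E := AlgTensor H)) _ _).trans
      (Finset.sum_congr rfl fun k _ => map_smul _ _ _)
  rw [e]
  exact Submodule.sum_mem _ fun k _ => Submodule.smul_mem _ _ (Submodule.subset_span ⟨_, rfl⟩)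

/-- A bounded operator is determined by its matrix elements between elementary tensors. -/
theorem HilbertTensor.ext_inner_tprod {A B : HilbertTensor H →L[ℂ] HilbertTensor H}
    (h : ∀ x y : ∀ i, H i, inner ℂ (HilbertTensor.tprod x) (A (HilbertTensor.tprod y)) =
      inner ℂ (HilbertTensor.tprod x) (B (HilbertTensor.tprod y))) : A = B := by
  have hd := Submodule.dense_iff_topologicalClosure_eq_top.2
    (HilbertTensor.topologicalClosure_span_tprod (H := H))
  refine ContinuousLinearMap.ext_on hd ?_
  rintro _ ⟨y, rfl⟩
  refine hd.eq_of_inner_right ℂ fun v hv => ?_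
  induction hv using Submodule.span_induction with
  | mem v hv => obtain ⟨x, rfl⟩ := hv; exact h x y
  | zero => simp
  | add u v _ _ hu hv => simp [inner_add_left, hu, hv]
  | smul c v _ hv => simp [inner_smul_left, hv]

theorem inner_tprod_tensorOp (A : ∀ i, H i →L[ℂ] H i) (x y : ∀ i, H i) :
    inner ℂ (HilbertTensor.tprod x) (tensorOp A (HilbertTensor.tprod y)) =
      ∏ i, inner ℂ (x i) (A i (y i)) := by
  rw [tensorOp_tprod, HilbertTensor.inner_tprod]

theorem tensorOp_one : tensorOp (fun i => (1 : H i →L[ℂ] H i)) = 1 :=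
  HilbertTensor.ext_inner_tprod fun x y => by
    rw [inner_tprod_tensorOp]; simp [HilbertTensor.inner_tprod]

/-- A tensor product of positive operators is positive, being the square of the tensor product of
the square roots. -/
theorem tensorOp_isPositive [∀ i, CompleteSpace (H i)] {A : ∀ i, H i →L[ℂ] H i}
    (hA : ∀ i, (A i).IsPositive) : (tensorOp A).IsPositive := by
  choose R hR hAR using fun i => (hA i).exists_sqrt
  have hRs : ∀ i x y, inner ℂ (R i x) y = inner ℂ x (R i y) := fun i x y => by
    rw [← ContinuousLinearMap.adjoint_inner_right, (hR i).adjoint_eq]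
  have h : tensorOp A = ContinuousLinearMap.adjoint (tensorOp R) ∘L tensorOp R := by
    refine HilbertTensor.ext_inner_tprod fun x y => ?_
    rw [inner_tprod_tensorOp, ContinuousLinearMap.comp_apply,
      ContinuousLinearMap.adjoint_inner_right, tensorOp_tprod, tensorOp_tprod,
      HilbertTensor.inner_tprod]
    exact Finset.prod_congr rfl fun i _ => by rw [hRs, hAR i]; rfl
  rw [h]
  exact ContinuousLinearMap.isPositive_adjoint_comp_self _

end TensorOp

/-! ### The scalar measures of a POV measure -/

namespace POVMeasure

variable {Λ : Type*} [MeasurableSpace Λ] {K : Type*} [NormedAddCommGroup K]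
  [InnerProductSpace ℂ K] (M : POVMeasure Λ K)

theorem inner_empty (x y : K) : inner ℂ x (M.toFun ∅ y) = 0 := by
  have h := M.hasSum_iUnion (fun _ => ∅) (fun _ => MeasurableSet.empty)
    (fun _ _ _ => by simp [Function.onFun]) x y
  exact tendsto_nhds_unique tendsto_const_nhds h.summable.tendsto_atTop_zero

theorem re_inner_nonneg {F : Set Λ} (hF : MeasurableSet F) (x : K) :
    0 ≤ (inner ℂ x (M.toFun F x)).re :=
  (Complex.le_def.1 ((M.isPositive F hF).inner_nonneg_right x)).1

/-- The measure `F ↦ ⟪x, M(F) x⟫`. -/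
noncomputable def diagMeasure (x : K) : Measure Λ :=
  Measure.ofMeasurable (fun F _ => ENNReal.ofReal (inner ℂ x (M.toFun F x)).re)
    (by simp [inner_empty]) (by
      intro F hF hd
      have h := (M.hasSum_iUnion F hF hd x x).mapL Complex.reCLM
      rw [← ENNReal.ofReal_tsum_of_nonneg (fun i => M.re_inner_nonneg (hF i) x) h.summable]
      exact congrArg _ h.tsum_eq.symm)

theorem diagMeasure_apply (x : K) {F : Set Λ} (hF : MeasurableSet F) :
    M.diagMeasure x F = ENNReal.ofReal (inner ℂ x (M.toFun F x)).re :=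
  Measure.ofMeasurable_apply F hF

instance (x : K) : IsFiniteMeasure (M.diagMeasure x) :=
  ⟨by rw [diagMeasure_apply _ _ MeasurableSet.univ]; exact ENNReal.ofReal_lt_top⟩

theorem inner_eq_diagMeasure_real (x : K) {F : Set Λ} (hF : MeasurableSet F) :
    inner ℂ x (M.toFun F x) = ((M.diagMeasure x).real F : ℂ) := by
  have h := Complex.le_def.1 ((M.isPositive F hF).inner_nonneg_right x)
  rw [measureReal_def, diagMeasure_apply _ _ hF, ENNReal.toReal_ofReal h.1]
  exact Complex.ext rfl h.2.symm

/-- Polarisation: `⟪x, M(·) y⟫` is a combination of four finite measures. -/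
theorem exists_inner_eq_sum (x y : K) : ∃ (a : Fin 4 → ℂ) (v : Fin 4 → K),
    ∀ F, MeasurableSet F →
      inner ℂ x (M.toFun F y) = ∑ k, a k * ((M.diagMeasure (v k)).real F : ℂ) := by
  refine ⟨![1 / 4, -1 / 4, -Complex.I / 4, Complex.I / 4],
    ![x + y, x - y, x + Complex.I • y, x - Complex.I • y], fun F hF => ?_⟩
  have hs : ∀ u v, inner ℂ (M.toFun F u) v = inner ℂ u (M.toFun F v) :=
    (M.isPositive F hF).1
  have h := inner_map_polarization' (M.toFun F).toLinearMap x y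
  simp only [ContinuousLinearMap.coe_coe, hs, M.inner_eq_diagMeasure_real _ hF] at h
  rw [h]
  simp [Fin.sum_univ_four]
  ring

end POVMeasure

/-! ### The product of POV measures on boxes -/

section Boxes

variable {ι : Type*} {Λ : ι → Type*} [∀ i, MeasurableSpace (Λ i)]

variable (Λ) in
/-- The measurable boxes `∏ i, F i`. -/
def boxes : Set (Set (∀ i, Λ i)) :=
  Set.pi Set.univ '' Set.pi Set.univ fun i => {s : Set (Λ i) | MeasurableSet s}

theorem mem_boxes {E : Set (∀ i, Λ i)} :
    E ∈ boxes Λ ↔ ∃ F : ∀ i, Set (Λ i), (∀ i, MeasurableSet (F i)) ∧ Set.pi Set.univ F = E := by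
  simp [boxes, Set.mem_pi]

theorem univ_mem_boxes : Set.univ ∈ boxes Λ :=
  mem_boxes.2 ⟨fun _ => Set.univ, fun _ => MeasurableSet.univ, Set.pi_univ _⟩

variable [Fintype ι]

/-- The difference of the boxes of `F` and `G` is the disjoint union of the boxes with sides
`F i ∩ G i` or `F i \ G i`, at least one of which is of the second kind. -/
theorem isSetSemiring_boxes [Nonempty ι] : IsSetSemiring (boxes Λ) where
  empty_mem := mem_boxes.2 ⟨fun _ => ∅, fun _ => MeasurableSet.empty, by
    ext; simp⟩
  inter_mem := by
    rintro _ hs _ ht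
    obtain ⟨F, hF, rfl⟩ := mem_boxes.1 hs
    obtain ⟨G, hG, rfl⟩ := mem_boxes.1 ht
    exact mem_boxes.2 ⟨_, fun i => (hF i).inter (hG i), Set.pi_inter_distrib⟩
  sdiff_eq_sUnion' := by
    classical
    rintro _ hs _ ht
    obtain ⟨F, hF, rfl⟩ := mem_boxes.1 hs
    obtain ⟨G, hG, rfl⟩ := mem_boxes.1 ht
    let B : (ι → Bool) → Set (∀ i, Λ i) := fun ε =>
      Set.pi Set.univ fun i => if ε i then F i ∩ G i else F i \ G i
    have hdisj : ∀ ε δ, ε ≠ δ → Disjoint (B ε) (B δ) := by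
      intro ε δ hne
      obtain ⟨i, hi⟩ := Function.ne_iff.1 hne
      refine Set.disjoint_left.2 fun z hz hz' => ?_
      have h1 := hz i trivial
      have h2 := hz' i trivial
      cases h : ε i <;> cases h' : δ i <;> simp_all
    refine ⟨(Finset.univ.filter fun ε : ι → Bool => ∃ i, ε i = false).image B, ?_, ?_, ?_⟩
    · intro E hE
      obtain ⟨ε, -, rfl⟩ := Finset.mem_image.1 hE
      refine mem_boxes.2 ⟨_, fun i => ?_, rfl⟩
      split_ifs
      exacts [(hF i).inter (hG i), (hF i).diff (hG i)]
    · intro E hE E' hE' hne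
      obtain ⟨ε, -, rfl⟩ := Finset.mem_image.1 hE
      obtain ⟨δ, -, rfl⟩ := Finset.mem_image.1 hE'
      exact hdisj ε δ fun h => hne (h ▸ rfl)
    · ext z
      simp only [Set.mem_sdiff, Set.mem_pi, Set.mem_univ, true_implies, not_forall,
        Finset.coe_image, Finset.coe_filter, Finset.mem_univ, true_and, Set.sUnion_image,
        Set.mem_iUnion, B, Set.mem_ofPred_eq, exists_prop]
      constructor
      · rintro ⟨hz, i, hi⟩
        refine ⟨fun j => decide (z j ∈ G j), ⟨i, by simpa using hi⟩, fun j => ?_⟩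
        by_cases hj : z j ∈ G j <;> simp [hj, hz j]
      · rintro ⟨ε, ⟨i, hi⟩, hz⟩
        refine ⟨fun j => ?_, i, ?_⟩
        · have := hz j
          split_ifs at this
          exacts [this.1, this.1]
        · have := hz i
          simp only [hi] at this
          exact this.2

variable {H : ι → Type*} [∀ i, NormedAddCommGroup (H i)] [∀ i, InnerProductSpace ℂ (H i)]
  (M : ∀ i, POVMeasure (Λ i) (H i))

open Classical in
/-- The matrix elements of `⨂ i, M i (F i)` between elementary tensors are combinations of finite
product measures, evaluated on the box `∏ i, F i`. -/
theorem exists_inner_tprod_tensorOp_eq_sum (x y : ∀ i, H i) :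
    ∃ (c : (ι → Fin 4) → ℂ) (μ : (ι → Fin 4) → Measure (∀ i, Λ i)),
      (∀ k, IsFiniteMeasure (μ k)) ∧ ∀ F : ∀ i, Set (Λ i), (∀ i, MeasurableSet (F i)) →
        inner ℂ (HilbertTensor.tprod x)
          (tensorOp (fun i => (M i).toFun (F i)) (HilbertTensor.tprod y)) =
        ∑ k, c k * ((μ k).real (Set.pi Set.univ F) : ℂ) := by
  choose a v hav using fun i => (M i).exists_inner_eq_sum (x i) (y i)
  refine ⟨fun k => ∏ i, a i (k i),
    fun k => Measure.pi fun i => (M i).diagMeasure (v i (k i)), fun k => inferInstance,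
    fun F hF => ?_⟩
  rw [inner_tprod_tensorOp, Finset.prod_congr rfl fun i _ => hav i (F i) (hF i),
    Finset.prod_univ_sum, Fintype.piFinset_univ]
  refine Finset.sum_congr rfl fun k _ => ?_
  rw [Finset.prod_mul_distrib, measureReal_def, Measure.pi_pi, ENNReal.toReal_prod,
    Complex.ofReal_prod]
  rfl

open Classical in
/-- The operator `⨂ i, M i (F i)` as a function of the box `∏ i, F i`; the value is `0` on other
sets. -/
noncomputable def boxOp (E : Set (∀ i, Λ i)) : HilbertTensor H →L[ℂ] HilbertTensor H :=
  if h : ∃ F : ∀ i, Set (Λ i), (∀ i, MeasurableSet (F i)) ∧ Set.pi Set.univ F = E then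
    tensorOp fun i => (M i).toFun (h.choose i) else 0

/-- Distinct families `F` may have the same (empty) box, but then they give the same operator. -/
theorem boxOp_pi {F : ∀ i, Set (Λ i)} (hF : ∀ i, MeasurableSet (F i)) :
    boxOp M (Set.pi Set.univ F) = tensorOp fun i => (M i).toFun (F i) := by
  have h : ∃ G : ∀ i, Set (Λ i), (∀ i, MeasurableSet (G i)) ∧
    Set.pi Set.univ G = Set.pi Set.univ F := ⟨F, hF, rfl⟩
  rw [boxOp, dif_pos h]
  refine HilbertTensor.ext_inner_tprod fun x y => ?_
  obtain ⟨c, μ, -, hμ⟩ := exists_inner_tprod_tensorOp_eq_sum M x y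
  rw [hμ _ h.choose_spec.1, hμ _ hF, h.choose_spec.2]

/-- `boxOp` as a finitely additive function on the semiring of boxes. -/
noncomputable def boxContent [Nonempty ι] :
    AddContent (HilbertTensor H →L[ℂ] HilbertTensor H) (boxes Λ) where
  toFun := boxOp M
  empty' := by
    have e : (∅ : Set (∀ i, Λ i)) = Set.pi Set.univ fun _ => ∅ := by ext; simp
    rw [e, boxOp_pi M fun _ => MeasurableSet.empty]
    refine HilbertTensor.ext_inner_tprod fun x y => ?_
    rw [inner_tprod_tensorOp]
    simp [POVMeasure.inner_empty]
  sUnion' I hI hd hU := by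
    classical
    refine HilbertTensor.ext_inner_tprod fun x y => ?_
    obtain ⟨c, μ, _, hμ⟩ := exists_inner_tprod_tensorOp_eq_sum M x y
    have hμ' : ∀ E ∈ boxes Λ, inner ℂ (HilbertTensor.tprod x)
        (boxOp M E (HilbertTensor.tprod y)) = ∑ k, c k * ((μ k).real E : ℂ) := by
      rintro E hE
      obtain ⟨F, hF, rfl⟩ := mem_boxes.1 hE
      rw [boxOp_pi M hF, hμ F hF]
    have hm : ∀ E ∈ I, MeasurableSet E := fun E hE => by
      obtain ⟨F, hF, rfl⟩ := mem_boxes.1 (hI hE)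
      exact MeasurableSet.univ_pi hF
    rw [hμ' _ hU]
    simp only [sum_apply, inner_sum]
    rw [Finset.sum_congr rfl fun E hE => hμ' E (hI hE), Finset.sum_comm]
    refine Finset.sum_congr rfl fun k _ => ?_
    rw [Set.sUnion_eq_biUnion, ← Finset.mul_sum]
    have := measureReal_biUnion_finset (μ := μ k) hd hm
    simp only [id] at this
    rw [← Complex.ofReal_sum, ← this]
    rfl

variable [∀ i, CompleteSpace (H i)] [Nonempty ι]

theorem boxContent_isPositive : ∀ E ∈ boxes Λ, (boxContent M E).IsPositive := by
  intro E hE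
  obtain ⟨F, hF, rfl⟩ := mem_boxes.1 hE
  change (boxOp M _).IsPositive
  rw [boxOp_pi M hF]
  exact tensorOp_isPositive fun i => (M i).isPositive _ (hF i)

/-- Every vector `ψ` of the Hilbert tensor product gives a measure on the product space, with
value `⟪ψ, (⨂ i, M i (F i)) ψ⟫` on the box `∏ i, F i`. For elementary tensors this is a product
measure. -/
theorem exists_measure_pi_eq_inner (ψ : HilbertTensor H) :
    ∃ μ : Measure (∀ i, Λ i), ∀ F : ∀ i, Set (Λ i), (∀ i, MeasurableSet (F i)) →
      μ (Set.pi Set.univ F) =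
        ENNReal.ofReal (inner ℂ ψ (tensorOp (fun i => (M i).toFun (F i)) ψ)).re := by
  have hd : (dominatedVectors (boxContent M) (boxContent_isPositive M)).topologicalClosure = ⊤ := by
    rw [eq_top_iff, ← HilbertTensor.topologicalClosure_span_tprod]
    refine Submodule.topologicalClosure_mono (Submodule.span_le.2 ?_)
    rintro _ ⟨x, rfl⟩
    refine ⟨Measure.pi fun i => (M i).diagMeasure (x i), inferInstance, fun E hE => ?_⟩
    obtain ⟨F, hF, rfl⟩ := mem_boxes.1 hE
    change ENNReal.ofReal (inner ℂ _ (boxOp M _ _)).re ≤ _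
    rw [boxOp_pi M hF, inner_tprod_tensorOp,
      Finset.prod_congr rfl fun i _ => (M i).inner_eq_diagMeasure_real (x i) (hF i),
      ← Complex.ofReal_prod, Complex.ofReal_re, Measure.pi_pi,
      ENNReal.ofReal_prod_of_nonneg fun i _ => measureReal_nonneg]
    simp
  obtain ⟨μ, hμ⟩ := exists_measure_eq_quadContent isSetSemiring_boxes generateFrom_pi.symm
    univ_mem_boxes hd ψ
  refine ⟨μ, fun F hF => ?_⟩
  rw [hμ _ (mem_boxes.2 ⟨F, hF, rfl⟩), ← boxOp_pi M hF]
  rfl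

/-- The quantum formula `tr[ρ (⨂ i, M i (F i))]` defines a joint probability distribution. -/
theorem exists_probabilityMeasure_hasTrace {ρ : HilbertTensor H →L[ℂ] HilbertTensor H}
    (hρ : IsQuantumState ρ) :
    ∃ P : ProbabilityMeasure (∀ i, Λ i), ∀ F : ∀ i, Set (Λ i), (∀ i, MeasurableSet (F i)) →
      HasTrace (ρ ∘L tensorOp (fun i => (M i).toFun (F i)))
        (((P : Measure (∀ i, Λ i)).real (Set.pi Set.univ F) : ℝ) : ℂ) := by
  obtain ⟨w, ψ, hψ, htr⟩ := hρ.exists_vectors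
  choose μ hμ using fun j => exists_measure_pi_eq_inner M (ψ j)
  have hval : ∀ F : ∀ i, Set (Λ i), (∀ i, MeasurableSet (F i)) →
      ((∑' j, inner ℂ (ψ j) (tensorOp (fun i => (M i).toFun (F i)) (ψ j))).re) =
        ((Measure.sum μ).real (Set.pi Set.univ F)) ∧
      (∑' j, inner ℂ (ψ j) (tensorOp (fun i => (M i).toFun (F i)) (ψ j))).im = 0 := by
    intro F hF
    have hpos := fun j => Complex.le_def.1
      ((tensorOp_isPositive fun i => (M i).isPositive _ (hF i)).inner_nonneg_right (ψ j))
    have hs := (htr (tensorOp fun i => (M i).toFun (F i))).1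
    constructor
    · rw [measureReal_def, Measure.sum_apply _ (MeasurableSet.univ_pi hF)]
      simp only [hμ _ F hF]
      rw [← ENNReal.ofReal_tsum_of_nonneg (fun j => (hpos j).1) (hs.mapL Complex.reCLM),
        ENNReal.toReal_ofReal (tsum_nonneg fun j => (hpos j).1)]
      exact Complex.reCLM.map_tsum hs
    · refine (Complex.imCLM.map_tsum hs).trans ?_
      simp [← (hpos _).2]
  have hprob : IsProbabilityMeasure (Measure.sum μ) := by
    constructor
    rw [Measure.sum_apply _ MeasurableSet.univ, ← Set.pi_univ Set.univ]
    simp only [hμ _ _ fun i => MeasurableSet.univ, POVMeasure.univ_eq_one, tensorOp_one]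
    have e : ∀ j, (inner ℂ (ψ j) ((1 : HilbertTensor H →L[ℂ] HilbertTensor H) (ψ j))).re =
        ‖ψ j‖ ^ 2 := fun j => inner_self_eq_norm_sq (𝕜 := ℂ) (ψ j)
    simp only [e]
    rw [← ENNReal.ofReal_tsum_of_nonneg (fun j => by positivity) hψ.summable, hψ.tsum_eq,
      ENNReal.ofReal_one]
  refine ⟨⟨Measure.sum μ, hprob⟩, fun F hF => ?_⟩
  convert! (htr (tensorOp fun i => (M i).toFun (F i))).2
  exact Complex.ext (by simpa using (hval F hF).1.symm) (by simpa using (hval F hF).2.symm)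

end Boxes

/-! ### Deterministic LqHV models of nonsignalling scenarios -/

section NoSignalling

/-- If the weights at each `i` other than that of `a i` sum to zero, then in a weighted sum of a
function of the coincidences of `t` with `a` only the term `t = a` survives. -/
theorem sum_prod_mul_coincidence {ι : Type*} [Fintype ι] [DecidableEq ι] {X : ι → Type*}
    [∀ i, Fintype (X i)] [∀ i, DecidableEq (X i)] (w : ∀ i, X i → ℝ) (a : ∀ i, X i)
    (g : (ι → Bool) → ℝ) (hw : ∀ i, ∑ x with x ≠ a i, w i x = 0) :
    ∑ t : ∀ i, X i, (∏ i, w i (t i)) * g (fun i => decide (t i = a i)) =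
      (∏ i, w i (a i)) * g fun _ => true := by
  rw [← Finset.sum_fiberwise Finset.univ (fun t : ∀ i, X i => fun i => decide (t i = a i))]
  have key : ∀ b : ι → Bool,
      ∑ t : ∀ i, X i with (fun i => decide (t i = a i)) = b,
        (∏ i, w i (t i)) * g (fun i => decide (t i = a i)) =
      (∏ i, ∑ x with decide (x = a i) = b i, w i x) * g b := by
    intro b
    rw [Finset.prod_univ_sum, Finset.sum_mul]
    refine Finset.sum_congr ?_ fun t ht => ?_
    · ext t; simp [funext_iff]
    · rw [Fintype.mem_piFinset] at ht
      congr 2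
      ext i
      simpa using ht i
  rw [Finset.sum_congr rfl fun b _ => key b, Finset.sum_eq_single fun _ => true]
  · simp [Finset.filter_eq']
  · intro b _ hb
    obtain ⟨i, hi⟩ := Function.ne_iff.1 hb
    rw [Finset.prod_eq_zero (Finset.mem_univ i), zero_mul]
    simpa [Bool.eq_false_iff.2 hi] using hw i
  · simp

theorem signedIntegral_indicator_one {Ω : Type*} [MeasurableSpace Ω] (ν : SignedMeasure Ω)
    {E : Set Ω} (hE : MeasurableSet E) :
    signedIntegral ν (E.indicator fun _ => (1 : ℝ)) = ν E := by
  conv_rhs => rw [← ν.toSignedMeasure_toJordanDecomposition]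
  simp [signedIntegral, integral_indicator hE, JordanDecomposition.toSignedMeasure,
    Measure.toSignedMeasure_apply_measurable hE]

variable {N : ℕ} {S : Fin N → ℕ} {Λ : Fin N → Type*} [∀ n, MeasurableSpace (Λ n)]

/-- The probability of an event which concerns only some of the sites does not depend on the
settings at the other sites. -/
def IsNonsignalling (P : CorrelationScenario S Λ) : Prop :=
  ∀ (s s' : ∀ n, Fin (S n)) (F : ∀ n, Set (Λ n)), (∀ n, MeasurableSet (F n)) →
    (∀ n, s n = s' n ∨ F n = Set.univ) →
    (P s : Measure (∀ n, Λ n)).real (Set.pi Set.univ F) =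
      (P s' : Measure (∀ n, Λ n)).real (Set.pi Set.univ F)

/-- The distribution of the outcome at the site `n` with setting `σ`, where `s₀` are the settings
at the other sites. -/
noncomputable def siteMarginal (P : CorrelationScenario S Λ) (s₀ : ∀ n, Fin (S n)) (n : Fin N)
    (σ : Fin (S n)) : Measure (Λ n) :=
  (P (Function.update s₀ n σ) : Measure (∀ n, Λ n)).map (Function.eval n)

instance (P : CorrelationScenario S Λ) (s₀ : ∀ n, Fin (S n)) (n : Fin N) (σ : Fin (S n)) :
    IsProbabilityMeasure (siteMarginal P s₀ n σ) :=
  Measure.isProbabilityMeasure_map (measurable_pi_apply n).aemeasurable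

/-- The outcomes for all settings at all sites, where for a site `n` with `t n = some σ` the outcome
for the setting `σ` is taken from `p.1` and all others are taken from `p.2`. -/
def insertOutcomes (t : ∀ n, Option (Fin (S n))) (p : (∀ n, Λ n) × (∀ n, Fin (S n) → Λ n)) :
    ∀ n, Fin (S n) → Λ n :=
  fun n σ => if t n = some σ then p.1 n else p.2 n σ

theorem measurable_insertOutcomes (t : ∀ n, Option (Fin (S n))) :
    Measurable (insertOutcomes (Λ := Λ) t) := by
  refine measurable_pi_iff.2 fun n => measurable_pi_iff.2 fun σ => ?_
  unfold insertOutcomes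
  split_ifs <;> fun_prop

/-- The joint law of the outcomes for all settings at all sites, in which the outcomes for the
settings selected by `t` are distributed jointly as in `P`, and all others are independent. -/
noncomputable def partialLaw (P : CorrelationScenario S Λ) (s₀ : ∀ n, Fin (S n))
    (t : ∀ n, Option (Fin (S n))) : Measure (∀ n, Fin (S n) → Λ n) :=
  ((P fun n => (t n).getD (s₀ n) : Measure (∀ n, Λ n)).prod
    (Measure.pi fun n => Measure.pi fun σ => siteMarginal P s₀ n σ)).map (insertOutcomes t)

instance (P : CorrelationScenario S Λ) (s₀ : ∀ n, Fin (S n)) (t : ∀ n, Option (Fin (S n))) :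
    IsProbabilityMeasure (partialLaw P s₀ t) :=
  Measure.isProbabilityMeasure_map (measurable_insertOutcomes t).aemeasurable

theorem measurableSet_settings_mem (s : ∀ n, Fin (S n)) {F : ∀ n, Set (Λ n)}
    (hF : ∀ n, MeasurableSet (F n)) :
    MeasurableSet {z : ∀ n, Fin (S n) → Λ n | ∀ n, z n (s n) ∈ F n} := by
  have e : {z : ∀ n, Fin (S n) → Λ n | ∀ n, z n (s n) ∈ F n} =
      ⋂ n, (fun z => z n (s n)) ⁻¹' F n := by ext; simp
  rw [e]
  exact MeasurableSet.iInter fun n => (by fun_prop : Measurable _) (hF n)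

theorem partialLaw_real_settings {P : CorrelationScenario S Λ} (hP : IsNonsignalling P)
    (s₀ : ∀ n, Fin (S n)) (t : ∀ n, Option (Fin (S n))) (s : ∀ n, Fin (S n)) {F : ∀ n, Set (Λ n)}
    (hF : ∀ n, MeasurableSet (F n)) :
    (partialLaw P s₀ t).real {z | ∀ n, z n (s n) ∈ F n} =
      (P s : Measure (∀ n, Λ n)).real
          (Set.pi Set.univ fun n => if decide (t n = some (s n)) then F n else Set.univ) *
        ∏ n, if decide (t n = some (s n)) then 1 else (siteMarginal P s₀ n (s n)).real (F n) := by
  have hpre : insertOutcomes t ⁻¹' {z : ∀ n, Fin (S n) → Λ n | ∀ n, z n (s n) ∈ F n} =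
      (Set.pi Set.univ fun n => if decide (t n = some (s n)) then F n else Set.univ) ×ˢ
        (Set.pi Set.univ fun n =>
          if decide (t n = some (s n)) then Set.univ else Function.eval (s n) ⁻¹' F n) := by
    ext ⟨x, y⟩
    simp only [insertOutcomes, Set.mem_preimage, Set.mem_ofPred_eq, Set.mem_prod, Set.mem_pi,
      Set.mem_univ, true_implies, ← forall_and]
    refine forall_congr' fun n => ?_
    by_cases h : t n = some (s n) <;> simp [h]
  rw [partialLaw, map_measureReal_apply (measurable_insertOutcomes t)
    (measurableSet_settings_mem s hF), hpre, measureReal_prod_prod]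
  congr 1
  · refine hP _ _ _ (fun n => ?_) fun n => ?_
    · split_ifs
      exacts [hF n, MeasurableSet.univ]
    · by_cases h : t n = some (s n) <;> simp [h]
  · rw [measureReal_def, Measure.pi_pi, ENNReal.toReal_prod]
    refine Finset.prod_congr rfl fun n _ => ?_
    by_cases h : t n = some (s n)
    · simp [h]
    · simp only [h, decide_false, Bool.false_eq_true, if_false]
      rw [(measurePreserving_eval _ (s n)).measure_preimage (hF n).nullMeasurableSet,
        measureReal_def]

/-- The weights of the signed combination of the laws `partialLaw P s₀ t`: the weight of `none`
balances `k - 1` of the `k` settings. -/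
def settingWeight (k : ℕ) (o : Option (Fin k)) : ℝ := o.elim (1 - k) fun _ => 1

theorem sum_settingWeight_ne (k : ℕ) (σ : Fin k) :
    ∑ o with o ≠ some σ, settingWeight k o = 0 := by
  have h : ∑ o, settingWeight k o = 1 := by
    simp [Fintype.sum_option, settingWeight]
  rw [← Finset.sum_filter_add_sum_filter_not Finset.univ (· ≠ some σ)] at h
  have h' : ∑ o with ¬ o ≠ some σ, settingWeight k o = 1 := by
    simp [Finset.filter_eq', settingWeight]
  linarith

/-- The quasi-distribution of the outcomes for all settings at all sites. -/
noncomputable def quasiLaw (P : CorrelationScenario S Λ) (s₀ : ∀ n, Fin (S n)) :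
    SignedMeasure (∀ n, Fin (S n) → Λ n) :=
  ∑ t : ∀ n, Option (Fin (S n)),
    (∏ n, settingWeight (S n) (t n)) • (partialLaw P s₀ t).toSignedMeasure

/-- The marginals of the quasi-distribution are the given joint distributions: when the outcome at
a site for the setting `s n` is tested, the `S n - 1` selections of another setting and the empty
selection, of weight `1 - S n`, cancel. -/
theorem quasiLaw_settings {P : CorrelationScenario S Λ} (hP : IsNonsignalling P)
    (s₀ s : ∀ n, Fin (S n)) {F : ∀ n, Set (Λ n)} (hF : ∀ n, MeasurableSet (F n)) :
    quasiLaw P s₀ {z | ∀ n, z n (s n) ∈ F n} =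
      (P s : Measure (∀ n, Λ n)).real (Set.pi Set.univ F) := by
  have hE := measurableSet_settings_mem s hF
  rw [quasiLaw, FunLike.coe_sum, Finset.sum_apply]
  simp only [smul_apply, Measure.toSignedMeasure_apply_measurable hE,
    partialLaw_real_settings hP s₀ _ s hF, smul_eq_mul]
  refine (sum_prod_mul_coincidence (fun n => settingWeight (S n)) (fun n => some (s n))
    (fun b => (P s : Measure (∀ n, Λ n)).real
          (Set.pi Set.univ fun n => if b n then F n else Set.univ) *
        ∏ n, if b n then 1 else (siteMarginal P s₀ n (s n)).real (F n))
    fun n => sum_settingWeight_ne _ _).trans ?_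
  simp [settingWeight]

/-- Every nonsignalling scenario admits a deterministic LqHV model, in which a hidden variable lists
the outcomes for all settings at all sites. -/
theorem IsNonsignalling.admitsDeterministicLqHV {P : CorrelationScenario S Λ}
    (hP : IsNonsignalling P) (hS : ∀ n, 1 ≤ S n) : AdmitsDeterministicLqHV P := by
  let s₀ : ∀ n, Fin (S n) := fun n => ⟨0, hS n⟩
  have hf : ∀ n (σ : Fin (S n)), Measurable fun z : ∀ n, Fin (S n) → Λ n => z n σ :=
    fun n σ => by fun_prop
  have hdet : ∀ n (σ : Fin (S n)) (z : ∀ n, Fin (S n) → Λ n) (F : Set (Λ n)), MeasurableSet F →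
      (Kernel.deterministic _ (hf n σ) z).real F =
        ((fun z => z n σ) ⁻¹' F).indicator (fun _ => (1 : ℝ)) z := fun n σ z F hF => by
    rw [measureReal_def, Kernel.deterministic_apply' _ _ hF]
    by_cases h : z n σ ∈ F <;> simp [h]
  refine ⟨{ Ω := ∀ n, Fin (S n) → Λ n
            ν := quasiLaw P s₀
            normalized := ?_
            condProb := fun n σ => Kernel.deterministic _ (hf n σ)
            isProbabilityMeasure_condProb := fun n σ => .of_forall fun z => inferInstance
            representation := fun s F hF => ?_ },
    fun n σ z => z n σ, hf, fun n σ => .of_forall fun z F hF => hdet n σ z F hF⟩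
  · have h := quasiLaw_settings hP s₀ s₀ (F := fun _ => Set.univ) fun _ => MeasurableSet.univ
    simpa using h
  · rw [← quasiLaw_settings hP s₀ s hF,
      ← signedIntegral_indicator_one _ (measurableSet_settings_mem s hF)]
    congr 1
    ext z
    simp only [hdet _ _ _ _ (hF _)]
    by_cases h : ∀ n, z n (s n) ∈ F n
    · simp [Set.indicator_of_mem, h]
    · obtain ⟨n, hn⟩ := not_forall.1 h
      rw [Finset.prod_eq_zero (Finset.mem_univ n) (by simp [hn])]
      simp [h]

/-- A quantum scenario is nonsignalling, because `M(Λ) = 1` for every measurement. -/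
theorem IsQuantumScenario.isNonsignalling {H : Fin N → Type*} [∀ n, NormedAddCommGroup (H n)]
    [∀ n, InnerProductSpace ℂ (H n)] {ρ : HilbertTensor H →L[ℂ] HilbertTensor H}
    {M : ∀ n, Fin (S n) → POVMeasure (Λ n) (H n)} {P : CorrelationScenario S Λ}
    (hP : IsQuantumScenario ρ M P) : IsNonsignalling P := by
  intro s s' F hF h
  have hM : (fun n => (M n (s n)).toFun (F n)) = fun n => (M n (s' n)).toFun (F n) := by
    ext1 n
    rcases h n with h | h
    · rw [h]
    · rw [h, POVMeasure.univ_eq_one, POVMeasure.univ_eq_one]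
  have h1 := hP s F hF
  rw [hM] at h1
  exact Complex.ofReal_injective (h1.unique (hP s' F hF))

end NoSignalling

/-- Every quantum correlation scenario admits a deterministic LqHV model. The first conjunct says
that the formula `tr[ρ (M 1 (s 1) (F 1) ⊗ ⋯ ⊗ M N (s N) (F N))]` does define joint probability
distributions on the product `σ`-algebra. -/
theorem corollary1 {N : ℕ} (hN : 2 ≤ N) (H : Fin N → Type*)
    [∀ n, NormedAddCommGroup (H n)] [∀ n, InnerProductSpace ℂ (H n)] [∀ n, CompleteSpace (H n)]
    [∀ n, TopologicalSpace.SeparableSpace (H n)]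
    (ρ : HilbertTensor H →L[ℂ] HilbertTensor H) (hρ : IsQuantumState ρ)
    (S : Fin N → ℕ) (hS : ∀ n, 1 ≤ S n)
    (Λ : Fin N → Type*) [∀ n, MeasurableSpace (Λ n)]
    (M : ∀ n, Fin (S n) → POVMeasure (Λ n) (H n)) :
    (∃ P : CorrelationScenario S Λ, IsQuantumScenario ρ M P) ∧
      ∀ P : CorrelationScenario S Λ, IsQuantumScenario ρ M P → AdmitsDeterministicLqHV P := by
  have : Nonempty (Fin N) := ⟨⟨0, by omega⟩⟩
  refine ⟨?_, fun P hP => hP.isNonsignalling.admitsDeterministicLqHV hS⟩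
  choose P hP using fun s : ∀ n, Fin (S n) =>
    exists_probabilityMeasure_hasTrace (fun n => M n (s n)) hρ
  exact ⟨P, fun s F hF => hP s F hF⟩
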